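/- Let $M$ be a smooth finite-dimensional manifold without boundary. A \emph{discretization map} on $M$ is a smooth map $R=(R^1,R^2)\colon U\to M\times M$, defined on an open neighbourhood $U\subset TM$ of the zero section, such that for every $x\in M$: (1) $R(0_x)=(x,x)$; (2) $T_{0_x}R^2_x-T_{0_x}R^1_x=\mathrm{Id}_{T_xM}$, where $R^a_x$ is the restriction of $R^a$ to $U\cap T_xM$ and $T_{0_x}T_xM\simeq T_xM$. Let $Q$ be a smooth finite-dimensional manifold without boundary and let $R_d\colon U\subset TQ\to Q\times Q$ be a discretization map on $Q$. Let - $\alpha_Q\colon TT^*Q\to T^*TQ$ be the canonical isomorphism, given in the coordinates induced by a chart of $Q$ by $(q,p,\dot q,\dot p)\mapsto(q,\dot q,\dot p,p)$, i.e. the covector $(\delta q,\delta v)\mapsto \dot p(\delta q)+p(\delta v)$ at $(q,\dot q)\in TQ$; - $\widehat{R_d}$ be the map with values in $T^*(Q\times Q)$ that sends a covector $\beta\in T^*_{\xi}TQ$ to $\beta\circ(T_{\xi}R_d)^{-1}\in T^*_{R_d(\xi)}(Q\times Q)$, defined for all $\xi\in U$ at which $T_\xi R_d$ is invertible; - $\Phi\colon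 T^*Q\times T^*Q\to T^*(Q\times Q)$ be the bijection $(q_0,p_0;q_1,p_1)\mapsto(q_0,q_1,-p_0,p_1)$. Then the cotangent lift $R_d^{T^*}=\Phi^{-1}\circ\widehat{R_d}\circ\alpha_Q$, defined on the set of all $X\in TT^*Q$ such that $\alpha_Q(X)$ is a covector at a point $\xi\in U$ with $T_\xi R_d$ invertible, is a discretization map on $T^*Q$. That is, this set is an open neighbourhood of the zero section of $TT^*Q$, $R_d^{T^*}$ is smooth on it, $R_d^{T^*}(0_{(q,p)})=((q,p),(q,p))$ for every $(q,p)\in T^*Q$, and the difference $T_{0}\big(R_d^{T^*}\big)^2_{(q,p)}-T_{0}\big(R_d^{T^*}\big)^1_{(q,p)}$ of the derivatives at zero of the restrictions of the two components to the fibre $T_{(q,p)}T^*Q$ is the identity of $T_{(q,p)}T^*Q$. -/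

import Mathlib

open Bundle
open scoped Manifold ContDiff

noncomputable section

namespace DiscretizationMap

universe u v w

variable {E : Type u} [NormedAddCommGroup E] [NormedSpace ℝ E]
  {H : Type v} [TopologicalSpace H] (I : ModelWithCorners ℝ E H)
  {M : Type w} [TopologicalSpace M] [ChartedSpace H M]

/-- The derivative `T_{0ₓ}fₓ : T_{0ₓ}TₓM ≃ TₓM → T_{f(0ₓ)}M` at zero of the restriction `fₓ` of
`f : TM → M` to the fibre `TₓM`. In Mathlib, `T_yM` is the model space `E` for each `y`, a tangent
vector being represented by its coordinates in the preferred chart at `y`. -/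
def fiberDeriv (f : TangentBundle I M → M) (x : M) : E →L[ℝ] E :=
  mfderiv 𝓘(ℝ, E) I (fun u : E => f (⟨x, u⟩ : TangentBundle I M)) 0

/-- A map `R = (R¹, R²) : U ⊆ TM → M × M` is a (smooth) discretization map on `M`:
`U` is an open neighbourhood of the zero section, `R` is smooth on `U`, `R(0ₓ) = (x, x)`, and the
difference of the derivatives at `0ₓ` of the restrictions `R²ₓ, R¹ₓ` to the fibre `TₓM` is the
identity of `TₓM`. Outside `U` the values of `R` are irrelevant. -/
structure IsDiscretizationMap [IsManifold I 1 M]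
    (U : Set (TangentBundle I M)) (R : TangentBundle I M → M × M) : Prop where
  isOpen_domain : IsOpen U
  zero_mem : ∀ x : M, (⟨x, 0⟩ : TangentBundle I M) ∈ U
  contMDiffOn : ContMDiffOn I.tangent (I.prod I) ∞ R U
  map_zero : ∀ x : M, R ⟨x, 0⟩ = (x, x)
  /-- Both derivatives take their values in `TₓM`, because `Rᵃ(0ₓ) = x` by `map_zero`. -/
  fiberDeriv_sub : ∀ x : M,
    fiberDeriv I (fun ξ => (R ξ).2) x - fiberDeriv I (fun ξ => (R ξ).1) x =
      ContinuousLinearMap.id ℝ E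

/-- The cotangent space `T*ₓM`. -/
abbrev CotangentSpace (x : M) : Type u := TangentSpace I x →L[ℝ] Bundle.Trivial M ℝ x

variable (M) in
/-- The cotangent bundle `T*M`, the bundle of continuous linear maps from `TM` to the trivial
line bundle, with the vector bundle and manifold structure that Mathlib gives to such a bundle. -/
abbrev CotangentBundle : Type (max w u) :=
  TotalSpace (E →L[ℝ] ℝ) (CotangentSpace I : M → Type u)

variable (E) in
/-- The model with corners of the manifold `T*M`. -/
abbrev cotangentModel : ModelWithCorners ℝ (E × (E →L[ℝ] ℝ)) (ModelProd H (E →L[ℝ] ℝ)) :=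
  I.prod 𝓘(ℝ, E →L[ℝ] ℝ)

/-- `F̂ = T*(F⁻¹) : T*M₁ → T*M₂`, sending `α ∈ T*ₓM₁` to the covector `α ∘ (TₓF)⁻¹` at `F x`. It is
only meaningful at points `x` where `F` is a local diffeomorphism, i.e. `TₓF` is invertible. -/
def hat {E' : Type*} [NormedAddCommGroup E'] [NormedSpace ℝ E']
    {H' : Type*} [TopologicalSpace H'] (I' : ModelWithCorners ℝ E' H')
    {M' : Type*} [TopologicalSpace M'] [ChartedSpace H' M'] (F : M → M')
    (a : CotangentBundle I M) : CotangentBundle I' M' :=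
  ⟨F a.proj, a.snd ∘L (mfderiv I I' F a.proj).inverse⟩

/-- `Φ : T*M × T*M → T*(M × M)`, `(q₀, p₀; q₁, p₁) ↦ (q₀, q₁, -p₀, p₁)`. -/
def Phi : CotangentBundle I M × CotangentBundle I M ≃ CotangentBundle (I.prod I) (M × M) where
  toFun a := ⟨(a.1.proj, a.2.proj),
    ContinuousLinearMap.coprod (M₁ := E) (M₂ := E) (-a.1.snd : E →L[ℝ] ℝ) (a.2.snd : E →L[ℝ] ℝ)⟩
  invFun b := (⟨b.proj.1, -((b.snd : E × E →L[ℝ] ℝ) ∘L ContinuousLinearMap.inl ℝ E E)⟩,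
    ⟨b.proj.2, (b.snd : E × E →L[ℝ] ℝ) ∘L ContinuousLinearMap.inr ℝ E E⟩)
  left_inv a := by
    have h₁ : ∀ p r : E →L[ℝ] ℝ,
        -(ContinuousLinearMap.coprod (-p) r ∘L ContinuousLinearMap.inl ℝ E E) = p := by
      intro p r; ext u; simp
    have h₂ : ∀ p r : E →L[ℝ] ℝ,
        ContinuousLinearMap.coprod (-p) r ∘L ContinuousLinearMap.inr ℝ E E = r := by
      intro p r; ext u; simp
    exact Prod.ext (congrArg (TotalSpace.mk a.1.proj) (h₁ a.1.snd a.2.snd))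
      (congrArg (TotalSpace.mk a.2.proj) (h₂ a.1.snd a.2.snd))
  right_inv b := by
    have h : ∀ s : E × E →L[ℝ] ℝ,
        ContinuousLinearMap.coprod (- -(s ∘L ContinuousLinearMap.inl ℝ E E))
          (s ∘L ContinuousLinearMap.inr ℝ E E) = s := by
      intro s; ext u <;> simp
    exact congrArg (TotalSpace.mk b.proj) (h b.snd)

variable [IsManifold I ∞ M]

/-- The Tulczyjew isomorphism `α_M : TT*M → T*TM`, `(q, p, q̇, ṗ) ↦ (q, q̇, ṗ, p)`: the value is the
covector `(δq, δv) ↦ ṗ(δq) + p(δv)` at `(q, q̇) ∈ TM`. The coordinates are those induced by the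
preferred chart of `M` at `q`: in Mathlib the preferred charts of `T*M` at `(q, p)` and of `TM` at
`(q, q̇)` are the ones induced by it, and a tangent vector at these points is represented by its
coordinates in them. -/
def alpha (X : TangentBundle (cotangentModel E I) (CotangentBundle I M)) :
    CotangentBundle I.tangent (TangentBundle I M) :=
  ⟨⟨X.proj.proj, (X.snd : E × (E →L[ℝ] ℝ)).1⟩,
    ContinuousLinearMap.coprod (M₁ := E) (M₂ := E)
      (X.snd : E × (E →L[ℝ] ℝ)).2 (X.proj.snd : E →L[ℝ] ℝ)⟩

/-- The cotangent lift `Φ⁻¹ ∘ R̂ ∘ α_M : TT*M → T*M × T*M` of `R : TM → M × M`. -/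
def cotangentLift (R : TangentBundle I M → M × M) :
    TangentBundle (cotangentModel E I) (CotangentBundle I M) →
      CotangentBundle I M × CotangentBundle I M :=
  (Phi I).symm ∘ hat I.tangent (I.prod I) R ∘ alpha I

/-- The domain of the cotangent lift of `R : U ⊆ TM → M × M`: all `X ∈ TT*M` such that `α_M X` is a
covector at a point of `U` at which `R` is a local diffeomorphism, i.e. has invertible
derivative. -/
def cotangentLiftDomain (U : Set (TangentBundle I M)) (R : TangentBundle I M → M × M) :
    Set (TangentBundle (cotangentModel E I) (CotangentBundle I M)) :=
  {X | (alpha I X).proj ∈ U ∧ (mfderiv I.tangent (I.prod I) R (alpha I X).proj).IsInvertible}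

end DiscretizationMap

end

/-!
In the charts induced by a chart of `Q`, let `F` be the expression of `R`. The lift sends the
tangent vector `(v, r)` at `(x, p)` to the points `F (x, v)` together with the two components (the
first with its sign changed) of the covector `m (v, r) = (r, p) ∘ DF(x, v)⁻¹`. The conditions on
`F` give `DF(x, 0) (a, 0) = (a, a)`, make `DF(x, 0)` invertible, and give `m 0 (a, b) = p (b - a)`.
Differentiating `m (v, r) ∘ DF(x, v) = (r, p)` at `0` and evaluating at `(a, 0)`, we get
`Dm(0) (v, r) (a, a) + m 0 (D²F(x, 0) (0, v) (a, 0)) = r a`. By symmetry of `D²F`, the second term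
is `p` applied to the derivative, in the direction `a`, of the difference of the two components of
`DF(x, 0) (0, v)`; this difference is constantly `v`, so the term vanishes. What is left is the
fibre condition in the direction of the momenta.

Differentiating the transition maps of `T*Q` in the same way, and again using the symmetry of their
second derivatives, shows that `α` has the same formula in all induced charts, so it is smooth.
-/

noncomputable section

namespace DiscretizationMap

open Set Filter Topology

section Calculus

variable {X V W G : Type*} [NormedAddCommGroup X] [NormedSpace ℝ X]
  [NormedAddCommGroup V] [NormedSpace ℝ V] [NormedAddCommGroup W] [NormedSpace ℝ W]
  [NormedAddCommGroup G] [NormedSpace ℝ G]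

theorem eventually_isInvertible {T : Type*} [TopologicalSpace T] [CompleteSpace V]
    {L : T → V →L[ℝ] W} {x : T} (hL : ContinuousAt L x) (hi : (L x).IsInvertible) :
    ∀ᶠ y in 𝓝 x, (L y).IsInvertible := by
  obtain ⟨e, he⟩ := hi
  exact hL (he ▸ ContinuousLinearEquiv.nhds e)

variable [CompleteSpace V] {x : X} {L : X → V →L[ℝ] W} {L' : X →L[ℝ] V →L[ℝ] W}
  {c : X → V →L[ℝ] G} {c' : X →L[ℝ] V →L[ℝ] G}

theorem differentiableAt_comp_inverse (hL : DifferentiableAt ℝ L x) (hc : DifferentiableAt ℝ c x)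
    (hi : (L x).IsInvertible) : DifferentiableAt ℝ (fun y => c y ∘L (L y).inverse) x :=
  hc.clm_comp (((hi.contDiffAt_map_inverse (n := 1)).differentiableAt one_ne_zero).comp x hL)

-- Differentiate `(c y ∘L (L y).inverse) ∘L L y = c y`.
theorem fderiv_comp_inverse_add (hL : HasFDerivAt L L' x) (hc : HasFDerivAt c c' x)
    (hi : (L x).IsInvertible) (w : X) (u : V) :
    fderiv ℝ (fun y => c y ∘L (L y).inverse) x w (L x u) + c x ((L x).inverse (L' w u)) =
      c' w u := by
  have hm := (differentiableAt_comp_inverse hL.differentiableAt hc.differentiableAt hi).hasFDerivAt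
  have hcancel : (fun y => (c y ∘L (L y).inverse) ∘L L y) =ᶠ[𝓝 x] c := by
    filter_upwards [eventually_isInvertible hL.continuousAt hi] with y hy
    rw [ContinuousLinearMap.comp_assoc, hy.inverse_comp_self, ContinuousLinearMap.comp_id]
  have h := (hm.clm_comp hL).unique (hc.congr_of_eventuallyEq hcancel)
  simpa [add_comm] using DFunLike.congr_fun (DFunLike.congr_fun h w) u

end Calculus

section Transition

variable {E E' : Type*} [NormedAddCommGroup E] [NormedSpace ℝ E]
  [NormedAddCommGroup E'] [NormedSpace ℝ E']

/-- The tangent map `(x, v) ↦ (φ x, Dφ(x) v)` of a map `φ` between vector spaces. -/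
def tangentTransition (φ : E → E') (z : E × E) : E' × E' := (φ z.1, fderiv ℝ φ z.1 z.2)

/-- The cotangent map `(x, p) ↦ (φ x, p ∘ Dφ(x)⁻¹)` of a local diffeomorphism `φ` between vector
spaces. -/
def cotangentTransition (φ : E → E') (z : E × (E →L[ℝ] ℝ)) : E' × (E' →L[ℝ] ℝ) :=
  (φ z.1, z.2 ∘L (fderiv ℝ φ z.1).inverse)

variable {φ : E → E'} {x : E}

theorem fderiv_tangentTransition (hφ : ContDiffAt ℝ 2 φ x) (v : E) (d : E × E) :
    fderiv ℝ (tangentTransition φ) (x, v) d =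
      (fderiv ℝ φ x d.1, fderiv ℝ φ x d.2 + fderiv ℝ (fderiv ℝ φ) x d.1 v) := by
  have hφ' : HasFDerivAt φ (fderiv ℝ φ x) x := (hφ.differentiableAt two_ne_zero).hasFDerivAt
  have hφ'' : HasFDerivAt (fderiv ℝ φ) (fderiv ℝ (fderiv ℝ φ) x) x :=
    ((hφ.fderiv_right (m := 1) (by norm_num)).differentiableAt one_ne_zero).hasFDerivAt
  have h : HasFDerivAt (tangentTransition φ) _ (x, v) :=
    (hφ'.comp (x, v) hasFDerivAt_fst).prodMk
      ((hφ''.comp (x, v) hasFDerivAt_fst).clm_apply hasFDerivAt_snd)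
  rw [h.fderiv]
  simp

variable [CompleteSpace E]

theorem snd_fderiv_cotangentTransition_add (hφ : ContDiffAt ℝ 2 φ x)
    (hi : (fderiv ℝ φ x).IsInvertible) (p : E →L[ℝ] ℝ) (w : E × (E →L[ℝ] ℝ)) (u : E) :
    (fderiv ℝ (cotangentTransition φ) (x, p) w).2 (fderiv ℝ φ x u) +
      p ((fderiv ℝ φ x).inverse (fderiv ℝ (fderiv ℝ φ) x w.1 u)) = w.2 u := by
  have hφ' : DifferentiableAt ℝ φ x := hφ.differentiableAt two_ne_zero
  have hφ'' : HasFDerivAt (fderiv ℝ φ) (fderiv ℝ (fderiv ℝ φ) x) x :=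
    ((hφ.fderiv_right (m := 1) (by norm_num)).differentiableAt one_ne_zero).hasFDerivAt
  have hL : HasFDerivAt (fun z : E × (E →L[ℝ] ℝ) => fderiv ℝ φ z.1) _ (x, p) :=
    hφ''.comp (x, p) hasFDerivAt_fst
  have hmomentum : DifferentiableAt ℝ (fun z => (cotangentTransition φ z).2) (x, p) :=
    differentiableAt_comp_inverse hL.differentiableAt differentiableAt_snd hi
  have hsnd : fderiv ℝ (fun z => (cotangentTransition φ z).2) (x, p) w =
      (fderiv ℝ (cotangentTransition φ) (x, p) w).2 :=
    DFunLike.congr_fun (fderiv.snd (DifferentiableAt.prodMk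
      (hφ'.comp (x, p) differentiableAt_fst) hmomentum)) w
  rw [← hsnd]
  exact fderiv_comp_inverse_add hL hasFDerivAt_snd hi w u

theorem pairing_transition (hφ : ContDiffAt ℝ 2 φ x) (hi : (fderiv ℝ φ x).IsInvertible)
    (p : E →L[ℝ] ℝ) (w : E × (E →L[ℝ] ℝ)) (d : E × E) :
    (fderiv ℝ (cotangentTransition φ) (x, p) w).2 (fderiv ℝ (tangentTransition φ) (x, w.1) d).1 +
      p ((fderiv ℝ φ x).inverse (fderiv ℝ (tangentTransition φ) (x, w.1) d).2) =
      w.2 d.1 + p d.2 := by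
  have hsymm : fderiv ℝ (fderiv ℝ φ) x d.1 w.1 = fderiv ℝ (fderiv ℝ φ) x w.1 d.1 :=
    (hφ.isSymmSndFDerivAt (by simp)).eq _ _
  have hinv : (fderiv ℝ φ x).inverse (fderiv ℝ φ x d.2) = d.2 := hi.inverse_apply_self _
  rw [fderiv_tangentTransition hφ, ← snd_fderiv_cotangentTransition_add hφ hi p w d.1, map_add,
    map_add, hinv, hsymm]
  ring

end Transition

section Diagonal

variable {R V : Type*} [Ring R] [AddCommGroup V] [Module R V] [TopologicalSpace V]
  {L : V × V →L[R] V × V}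

theorem exists_apply_eq_of_diag (hdiag : ∀ a, L (a, 0) = (a, a))
    (hsub : ∀ v, (L (0, v)).2 - (L (0, v)).1 = v) :
    ∃ B : V →L[R] V, ∀ z, L z = (z.1 + B z.2, z.1 + B z.2 + z.2) := by
  refine ⟨.fst R V V ∘L L ∘L .inr R V V, fun z => ?_⟩
  have hz : L z = (z.1, z.1) + L (0, z.2) := by rw [← hdiag, ← map_add]; simp
  have hsnd : (L (0, z.2)).2 = (L (0, z.2)).1 + z.2 := (add_eq_of_eq_sub' (hsub z.2).symm).symm
  rw [hz]
  ext <;> simp [hsnd, add_assoc]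

theorem isInvertible_of_diag [IsTopologicalAddGroup V] (hdiag : ∀ a, L (a, 0) = (a, a))
    (hsub : ∀ v, (L (0, v)).2 - (L (0, v)).1 = v) : L.IsInvertible := by
  obtain ⟨B, hL⟩ := exists_apply_eq_of_diag hdiag hsub
  let diff : V × V →L[R] V := .snd R V V - .fst R V V
  refine .of_inverse (g := (.fst R V V - B ∘L diff).prod diff) ?_ ?_ <;>
    refine ContinuousLinearMap.ext fun z => ?_ <;>
    simp [diff, hL]

theorem snd_inverse_of_diag [IsTopologicalAddGroup V] (hdiag : ∀ a, L (a, 0) = (a, a))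
    (hsub : ∀ v, (L (0, v)).2 - (L (0, v)).1 = v) (z : V × V) :
    (L.inverse z).2 = z.2 - z.1 := by
  obtain ⟨B, hL⟩ := exists_apply_eq_of_diag hdiag hsub
  have hz : L (L.inverse z) = z := (isInvertible_of_diag hdiag hsub).self_apply_inverse z
  conv_rhs => rw [← hz, hL]
  exact (add_sub_cancel_left _ _).symm

end Diagonal

section LocalDiscretization

variable {E : Type*} [NormedAddCommGroup E] [NormedSpace ℝ E] {F : E × E → E × E} {x : E}

/-- The conditions defining a discretization map, for the expression `F` of such a map in a chart
near `x`: here `(y, v) : E × E` is the tangent vector `v` at `y`. Two derivatives are enough for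
the cotangent lift. -/
structure IsLocalDiscretization (F : E × E → E × E) (x : E) : Prop where
  contDiffAt : ContDiffAt ℝ 2 F (x, 0)
  map_zero : ∀ᶠ y in 𝓝 x, F (y, 0) = (y, y)
  fderiv_sub : ∀ᶠ y in 𝓝 x, ∀ v, (fderiv ℝ F (y, 0) (0, v)).2 - (fderiv ℝ F (y, 0) (0, v)).1 = v

/-- The covector `(r, p) ∘ DF(x, v)⁻¹` on `E × E`, as a function of `w = (v, r)`. -/
def momentum (F : E × E → E × E) (x : E) (p : E →L[ℝ] ℝ) (w : E × (E →L[ℝ] ℝ)) :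
    E × E →L[ℝ] ℝ :=
  ContinuousLinearMap.coprod w.2 p ∘L (fderiv ℝ F (x, w.1)).inverse

/-- The expression in a chart of the cotangent lift of `F`, restricted to the tangent space of the
cotangent bundle at `(x, p)`. -/
def localLift (F : E × E → E × E) (x : E) (p : E →L[ℝ] ℝ) (w : E × (E →L[ℝ] ℝ)) :
    (E × (E →L[ℝ] ℝ)) × (E × (E →L[ℝ] ℝ)) :=
  (((F (x, w.1)).1, -(momentum F x p w ∘L .inl ℝ E E)),
    ((F (x, w.1)).2, momentum F x p w ∘L .inr ℝ E E))

theorem hasFDerivAt_coprod_left (p : E →L[ℝ] ℝ) (w : E × (E →L[ℝ] ℝ)) :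
    HasFDerivAt (fun w : E × (E →L[ℝ] ℝ) => w.2.coprod p)
      ((ContinuousLinearMap.fst ℝ E E).precomp ℝ ∘L .snd ℝ E (E →L[ℝ] ℝ)) w := by
  have h : (fun w : E × (E →L[ℝ] ℝ) => w.2.coprod p) = fun w =>
      ((ContinuousLinearMap.fst ℝ E E).precomp ℝ ∘L .snd ℝ E (E →L[ℝ] ℝ)) w +
        p ∘L .snd ℝ E E := by
    ext <;> simp
  rw [h]
  exact (ContinuousLinearMap.hasFDerivAt _).add_const _

namespace IsLocalDiscretization

theorem differentiableAt (hF : IsLocalDiscretization F x) : DifferentiableAt ℝ F (x, 0) :=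
  hF.contDiffAt.differentiableAt two_ne_zero

theorem hasFDerivAt_fderiv (hF : IsLocalDiscretization F x) :
    HasFDerivAt (fderiv ℝ F) (fderiv ℝ (fderiv ℝ F) (x, 0)) (x, 0) :=
  ((hF.contDiffAt.fderiv_right (m := 1) (by norm_num)).differentiableAt one_ne_zero).hasFDerivAt

theorem fderiv_diag (hF : IsLocalDiscretization F x) (a : E) :
    fderiv ℝ F (x, 0) (a, 0) = (a, a) := by
  have h : HasFDerivAt (fun y => F (y, 0)) _ x :=
    hF.differentiableAt.hasFDerivAt.comp x (hasFDerivAt_prodMk_left x (0 : E))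
  have hdiag : HasFDerivAt (fun y => F (y, 0)) _ x :=
    ((hasFDerivAt_id (𝕜 := ℝ) x).prodMk (hasFDerivAt_id x)).congr_of_eventuallyEq hF.map_zero
  simpa using DFunLike.congr_fun (h.unique hdiag) a

theorem isInvertible_fderiv (hF : IsLocalDiscretization F x) : (fderiv ℝ F (x, 0)).IsInvertible :=
  isInvertible_of_diag hF.fderiv_diag hF.fderiv_sub.self_of_nhds

theorem momentum_zero (hF : IsLocalDiscretization F x) (p : E →L[ℝ] ℝ) (z : E × E) :
    momentum F x p 0 z = p (z.2 - z.1) := by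
  rw [← snd_inverse_of_diag hF.fderiv_diag hF.fderiv_sub.self_of_nhds]
  simp [momentum]

theorem localLift_zero (hF : IsLocalDiscretization F x) (p : E →L[ℝ] ℝ) :
    localLift F x p 0 = ((x, p), (x, p)) := by
  have hx : F (x, 0) = (x, x) := hF.map_zero.self_of_nhds
  ext <;> simp [localLift, hx, hF.momentum_zero]

-- Differentiate condition `fderiv_sub` along the zero section.
theorem mixed_fderiv_sub (hF : IsLocalDiscretization F x) (a v : E) :
    (fderiv ℝ (fderiv ℝ F) (x, 0) (0, v) (a, 0)).2 =
      (fderiv ℝ (fderiv ℝ F) (x, 0) (0, v) (a, 0)).1 := by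
  have hsymm : fderiv ℝ (fderiv ℝ F) (x, 0) (0, v) (a, 0) =
      fderiv ℝ (fderiv ℝ F) (x, 0) (a, 0) (0, v) :=
    (hF.contDiffAt.isSymmSndFDerivAt (by simp)).eq _ _
  have h : HasFDerivAt (fun y => fderiv ℝ F (y, 0) (0, v)) _ x :=
    (hF.hasFDerivAt_fderiv.comp x (hasFDerivAt_prodMk_left x (0 : E))).clm_apply
      (hasFDerivAt_const (0, v) x)
  have hconst := (h.snd.sub h.fst).unique
    ((hasFDerivAt_const v x).congr_of_eventuallyEq (hF.fderiv_sub.mono fun y hy => hy v))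
  rw [hsymm, ← sub_eq_zero]
  simpa using DFunLike.congr_fun hconst a

theorem hasFDerivAt_fderiv_fiber (hF : IsLocalDiscretization F x) :
    HasFDerivAt (fun w : E × (E →L[ℝ] ℝ) => fderiv ℝ F (x, w.1))
      (fderiv ℝ (fderiv ℝ F) (x, 0) ∘L .inr ℝ E E ∘L .fst ℝ E (E →L[ℝ] ℝ)) 0 :=
  HasFDerivAt.comp (0 : E × (E →L[ℝ] ℝ)) (g := fderiv ℝ F) hF.hasFDerivAt_fderiv
    (HasFDerivAt.comp (0 : E × (E →L[ℝ] ℝ)) (hasFDerivAt_prodMk_right x (0 : E)) hasFDerivAt_fst)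

variable [CompleteSpace E]

theorem differentiableAt_momentum (hF : IsLocalDiscretization F x) (p : E →L[ℝ] ℝ) :
    DifferentiableAt ℝ (momentum F x p) 0 :=
  differentiableAt_comp_inverse hF.hasFDerivAt_fderiv_fiber.differentiableAt
    (hasFDerivAt_coprod_left p 0).differentiableAt hF.isInvertible_fderiv

theorem fderiv_momentum_diag (hF : IsLocalDiscretization F x) (p : E →L[ℝ] ℝ)
    (w : E × (E →L[ℝ] ℝ)) (a : E) : fderiv ℝ (momentum F x p) 0 w (a, a) = w.2 a := by
  have h : fderiv ℝ (momentum F x p) 0 w (fderiv ℝ F (x, 0) (a, 0)) +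
      momentum F x p 0 (fderiv ℝ (fderiv ℝ F) (x, 0) (0, w.1) (a, 0)) = w.2 a :=
    fderiv_comp_inverse_add hF.hasFDerivAt_fderiv_fiber (hasFDerivAt_coprod_left p 0)
      hF.isInvertible_fderiv w (a, 0)
  rwa [hF.fderiv_diag, hF.momentum_zero, hF.mixed_fderiv_sub, sub_self, _root_.map_zero,
    add_zero] at h

theorem fderiv_localLift_sub (hF : IsLocalDiscretization F x) (p : E →L[ℝ] ℝ)
    (w : E × (E →L[ℝ] ℝ)) :
    (fderiv ℝ (localLift F x p) 0 w).2 - (fderiv ℝ (localLift F x p) 0 w).1 = w := by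
  have hm := (hF.differentiableAt_momentum p).hasFDerivAt
  have hF' : HasFDerivAt (fun w : E × (E →L[ℝ] ℝ) => F (x, w.1)) _ 0 :=
    HasFDerivAt.comp (0 : E × (E →L[ℝ] ℝ)) (g := F) hF.differentiableAt.hasFDerivAt
      (HasFDerivAt.comp (0 : E × (E →L[ℝ] ℝ)) (hasFDerivAt_prodMk_right x (0 : E)) hasFDerivAt_fst)
  have hcomp (A : E →L[ℝ] E × E) : HasFDerivAt (fun w => momentum F x p w ∘L A)
      (A.precomp ℝ ∘L fderiv ℝ (momentum F x p) 0) 0 :=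
    (A.precomp ℝ : (E × E →L[ℝ] ℝ) →L[ℝ] E →L[ℝ] ℝ).hasFDerivAt.comp 0 hm
  have h : HasFDerivAt (localLift F x p) _ 0 :=
    (hF'.fst.prodMk (hcomp (.inl ℝ E E)).neg).prodMk (hF'.snd.prodMk (hcomp (.inr ℝ E E)))
  rw [h.fderiv]
  refine Prod.ext ?_ (ContinuousLinearMap.ext fun a => ?_)
  · simpa using hF.fderiv_sub.self_of_nhds w.1
  · have hdiag := hF.fderiv_momentum_diag p w a
    have hsplit : ((a, a) : E × E) = (0, a) + (a, 0) := by simp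
    rw [hsplit, map_add] at hdiag
    simpa using hdiag

end IsLocalDiscretization

end LocalDiscretization

section TangentCoordinates

variable {E : Type*} [NormedAddCommGroup E] [NormedSpace ℝ E]
  {H : Type*} [TopologicalSpace H] {I : ModelWithCorners ℝ E H}
  {M : Type*} [TopologicalSpace M] [ChartedSpace H M]
  {E' : Type*} [NormedAddCommGroup E'] [NormedSpace ℝ E']
  {H' : Type*} [TopologicalSpace H'] {I' : ModelWithCorners ℝ E' H'}
  {M' : Type*} [TopologicalSpace M'] [ChartedSpace H' M']

theorem eventually_extChartAt [I.Boundaryless] {P : E → Prop} {x₀ : M}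
    (hP : ∀ y ∈ (extChartAt I x₀).source, P (extChartAt I x₀ y)) :
    ∀ᶠ e in 𝓝 (extChartAt I x₀ x₀), P e := by
  filter_upwards [extChartAt_target_mem_nhds (I := I) x₀] with e he
  rw [← (extChartAt I x₀).right_inv he]
  exact hP _ ((extChartAt I x₀).map_target he)

theorem eventuallyEq_extChartAt_comp_symm [I.Boundaryless] {ψ : E → E} {x y z : M}
    (hx : z ∈ (extChartAt I x).source) (hy : z ∈ (extChartAt I y).source)
    (hψ : ∀ c ∈ (extChartAt I x).source, c ∈ (extChartAt I y).source →
      ψ (extChartAt I x c) = extChartAt I y c) :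
    extChartAt I y ∘ (extChartAt I x).symm =ᶠ[𝓝 (extChartAt I x z)] ψ := by
  have hsource : ∀ᶠ e in 𝓝 (extChartAt I x z),
      (extChartAt I x).symm e ∈ (extChartAt I y).source :=
    continuousAt_extChartAt_symm' hx
      (by rw [(extChartAt I x).left_inv hx]; exact extChartAt_source_mem_nhds' hy)
  filter_upwards [hsource, extChartAt_target_mem_nhds' ((extChartAt I x).map_source hx)]
    with e he' he
  rw [Function.comp_apply, ← hψ _ ((extChartAt I x).map_target he) he',
    (extChartAt I x).right_inv he]

theorem contDiffAt_chart_comp [I.Boundaryless] {n : WithTop ℕ∞} [IsManifold I n M]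
    [IsManifold I' n M'] {F : M → M'} {x₀ x : M} {y₀ : M'} (hF : ContMDiffAt I I' n F x)
    (hx : x ∈ (extChartAt I x₀).source) (hy : F x ∈ (extChartAt I' y₀).source) :
    ContDiffAt ℝ n (extChartAt I' y₀ ∘ F ∘ (extChartAt I x₀).symm) (extChartAt I x₀ x) := by
  rw [extChartAt_source] at hx hy
  have h := ((contMDiffAt_iff_of_mem_source hx hy).1 hF).2
  rwa [I.range_eq_univ, contDiffWithinAt_univ] at h

variable [IsManifold I 1 M]

theorem tangentCoordChange_comp_symm {x y z : M} (hx : z ∈ (extChartAt I x).source)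
    (hy : z ∈ (extChartAt I y).source) :
    tangentCoordChange I x y z ∘L tangentCoordChange I y x z = .id ℝ E := by
  ext v
  exact (tangentCoordChange_comp ⟨⟨hy, hx⟩, hy⟩).trans (tangentCoordChange_self hy)

theorem isInvertible_tangentCoordChange {x y z : M} (hx : z ∈ (extChartAt I x).source)
    (hy : z ∈ (extChartAt I y).source) : (tangentCoordChange I x y z).IsInvertible :=
  .of_inverse (tangentCoordChange_comp_symm hx hy) (tangentCoordChange_comp_symm hy hx)

theorem inverse_tangentCoordChange {x y z : M} (hx : z ∈ (extChartAt I x).source)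
    (hy : z ∈ (extChartAt I y).source) :
    (tangentCoordChange I x y z).inverse = tangentCoordChange I y x z :=
  ContinuousLinearMap.inverse_eq (tangentCoordChange_comp_symm hx hy)
    (tangentCoordChange_comp_symm hy hx)

theorem tangentCoordChange_self_eq_id {x z : M} (h : z ∈ (extChartAt I x).source) :
    tangentCoordChange I x x z = .id ℝ E :=
  ContinuousLinearMap.ext fun _ => tangentCoordChange_self h

theorem tangentCoordChange_eq_fderiv [I.Boundaryless] (x y z : M) :
    tangentCoordChange I x y z =
      fderiv ℝ (extChartAt I y ∘ (extChartAt I x).symm) (extChartAt I x z) := by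
  rw [tangentCoordChange_def, I.range_eq_univ, fderivWithin_univ]

theorem hasMFDerivAt_extChartAt_symm [I.Boundaryless] {x₀ x : M}
    (hx : x ∈ (extChartAt I x₀).source) :
    HasMFDerivAt 𝓘(ℝ, E) I (extChartAt I x₀).symm (extChartAt I x₀ x)
      (tangentCoordChange I x₀ x x : E →L[ℝ] E) := by
  have h := hasFDerivWithinAt_tangentCoordChange ⟨hx, mem_extChartAt_source (I := I) x⟩
  rw [I.range_eq_univ] at h
  refine ⟨continuousAt_extChartAt_symm' hx, ?_⟩
  rw [writtenInExtChartAt, (extChartAt I x₀).left_inv hx, modelWithCornersSelf_coe, range_id]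
  exact h

variable [IsManifold I' 1 M']

theorem tangentCoordChange_prod {x y z : M × M'} (hx : z ∈ (extChartAt (I.prod I') x).source)
    (hy : z ∈ (extChartAt (I.prod I') y).source) :
    tangentCoordChange (I.prod I') x y z =
      (tangentCoordChange I x.1 y.1 z.1).prodMap (tangentCoordChange I' x.2 y.2 z.2) := by
  have hmem : extChartAt (I.prod I') x z ∈ range (I.prod I') := mem_range_self _
  have h := hasFDerivWithinAt_tangentCoordChange (I := I.prod I') ⟨hx, hy⟩
  rw [extChartAt_prod] at hx hy hmem
  rw [extChartAt_prod, extChartAt_prod] at h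
  have h₁ := (hasFDerivWithinAt_tangentCoordChange (I := I) ⟨hx.1, hy.1⟩).mono
    (show Prod.fst '' range (I.prod I') ⊆ range I by
      rw [ModelWithCorners.range_prod]; exact fst_image_prod_subset _ _)
  have h₂ := (hasFDerivWithinAt_tangentCoordChange (I := I') ⟨hx.2, hy.2⟩).mono
    (show Prod.snd '' range (I.prod I') ⊆ range I' by
      rw [ModelWithCorners.range_prod]; exact snd_image_prod_subset _ _)
  exact (I.prod I').uniqueDiffOn.eq hmem h
    (HasFDerivWithinAt.prodMap (extChartAt I x.1 z.1, extChartAt I' x.2 z.2) h₁ h₂)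

/-- The matrix of the derivative of `F` at `x` in the charts of `M` at `x₀` and of `M'` at `y₀`. -/
def derivCoord (I : ModelWithCorners ℝ E H) (I' : ModelWithCorners ℝ E' H') [IsManifold I 1 M]
    [IsManifold I' 1 M'] (F : M → M') (x₀ : M) (y₀ : M') (x : M) : E →L[ℝ] E' :=
  tangentCoordChange I' (F x) y₀ (F x) ∘L (mfderiv I I' F x : E →L[ℝ] E') ∘L
    tangentCoordChange I x₀ x x

variable {F : M → M'} {x₀ x : M} {y₀ : M'}

theorem isInvertible_derivCoord_iff (hx : x ∈ (extChartAt I x₀).source)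
    (hy : F x ∈ (extChartAt I' y₀).source) :
    (derivCoord I I' F x₀ y₀ x).IsInvertible ↔ (mfderiv I I' F x).IsInvertible := by
  obtain ⟨e, he⟩ := isInvertible_tangentCoordChange (mem_extChartAt_source _) hy
  obtain ⟨e', he'⟩ := isInvertible_tangentCoordChange hx (mem_extChartAt_source (I := I) x)
  rw [derivCoord, ← he, ← he', ContinuousLinearMap.isInvertible_equiv_comp]
  exact ContinuousLinearMap.isInvertible_comp_equiv

theorem inverse_derivCoord (hx : x ∈ (extChartAt I x₀).source)
    (hy : F x ∈ (extChartAt I' y₀).source) :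
    (derivCoord I I' F x₀ y₀ x).inverse =
      tangentCoordChange I x x₀ x ∘L
        ContinuousLinearMap.inverse (M := E) (M₂ := E') (mfderiv I I' F x) ∘L
        tangentCoordChange I' y₀ (F x) (F x) := by
  have hx' := mem_extChartAt_source (I := I) x
  have hy' := mem_extChartAt_source (I := I') (F x)
  rw [derivCoord, (isInvertible_tangentCoordChange hy' hy).inverse_comp_of_left,
    inverse_tangentCoordChange hy' hy, ← inverse_tangentCoordChange hx hx']
  exact congrArg (· ∘L tangentCoordChange I' y₀ (F x) (F x))
    (isInvertible_tangentCoordChange hx hx').inverse_comp_of_right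

theorem contMDiffAt_derivCoord {m n : WithTop ℕ∞} (hF : ContMDiffAt I I' n F x)
    (hmn : m + 1 ≤ n) :
    ContMDiffAt I 𝓘(ℝ, E →L[ℝ] E') m (derivCoord I I' F x (F x)) x := by
  refine (hF.mfderiv_const hmn).congr_of_eventuallyEq ?_
  filter_upwards [extChartAt_source_mem_nhds (I := I) x,
    hF.continuousAt (extChartAt_source_mem_nhds (I := I') (F x))] with y hy hFy
  rw [mem_preimage] at hFy
  rw [extChartAt_source] at hy hFy
  exact (inTangentCoordinates_eq id F (mfderiv I I' F) hy hFy).symm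

theorem hasFDerivAt_chart_comp [I.Boundaryless] (hF : MDifferentiableAt I I' F x)
    (hx : x ∈ (extChartAt I x₀).source) (hy : F x ∈ (extChartAt I' y₀).source) :
    HasFDerivAt (extChartAt I' y₀ ∘ F ∘ (extChartAt I x₀).symm) (derivCoord I I' F x₀ y₀ x)
      (extChartAt I x₀ x) := by
  rw [extChartAt_source] at hy
  have hchart := hasMFDerivAt_extChartAt (I := I') hy
  rw [mfderiv_chartAt_eq_tangentCoordChange hy] at hchart
  have h := hchart.comp x hF.hasMFDerivAt
  exact (HasMFDerivAt.comp (extChartAt I x₀ x) (g := extChartAt I' y₀ ∘ F)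
    (by rwa [(extChartAt I x₀).left_inv hx]) (hasMFDerivAt_extChartAt_symm hx)).hasFDerivAt

end TangentCoordinates

section Covectors

variable {E : Type*} [NormedAddCommGroup E] [NormedSpace ℝ E]
  {H : Type*} [TopologicalSpace H] {I : ModelWithCorners ℝ E H}
  {M : Type*} [TopologicalSpace M] [ChartedSpace H M] [IsManifold I 1 M]

theorem extChartAt_tangentBundle_apply (a b : TangentBundle I M) :
    extChartAt I.tangent a b =
      (extChartAt I a.proj b.proj, tangentCoordChange I b.proj a.proj b.proj b.snd) := by
  rw [FiberBundle.extChartAt]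
  rfl

theorem mem_extChartAt_tangentBundle_source {a b : TangentBundle I M} :
    b ∈ (extChartAt I.tangent a).source ↔ b.proj ∈ (extChartAt I a.proj).source := by
  rw [extChartAt_source, extChartAt_source]
  exact TangentBundle.mem_chart_source_iff b a

/-- The components of a covector in the chart of `M` at `x₀`. -/
def covectorCoord (I : ModelWithCorners ℝ E H) [IsManifold I 1 M] (x₀ : M)
    (b : CotangentBundle I M) : E →L[ℝ] ℝ :=
  (b.snd : E →L[ℝ] ℝ) ∘L tangentCoordChange I x₀ b.proj b.proj

theorem covectorCoord_self (b : CotangentBundle I M) : covectorCoord I b.proj b = b.snd := by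
  rw [covectorCoord, tangentCoordChange_self_eq_id (mem_extChartAt_source _)]
  rfl

theorem covectorCoord_comp_tangentCoordChange {x y : M} {b : CotangentBundle I M}
    (hx : b.proj ∈ (extChartAt I x).source) (hy : b.proj ∈ (extChartAt I y).source) :
    covectorCoord I x b ∘L tangentCoordChange I y x b.proj = covectorCoord I y b := by
  ext v
  exact congrArg (b.snd : E →L[ℝ] ℝ)
    (tangentCoordChange_comp (I := I) ⟨⟨hy, hx⟩, mem_extChartAt_source _⟩)

theorem trivializationAt_cotangentBundle_snd {x₀ : M} {b : CotangentBundle I M}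
    (hb : b.proj ∈ (extChartAt I x₀).source) :
    (trivializationAt (E →L[ℝ] ℝ) (CotangentSpace I : M → Type _) x₀ b).2 =
      covectorCoord I x₀ b := by
  rw [extChartAt_source] at hb
  rw [hom_trivializationAt_apply]
  simp only [ContinuousLinearMap.inCoordinates]
  rw [TangentBundle.symmL_trivializationAt_eq_core hb]
  ext v
  simp [covectorCoord]

theorem extChartAt_cotangentBundle_apply {a b : CotangentBundle I M}
    (hb : b.proj ∈ (extChartAt I a.proj).source) :
    extChartAt (cotangentModel E I) a b =
      (extChartAt I a.proj b.proj, covectorCoord I a.proj b) := by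
  rw [FiberBundle.extChartAt, ← trivializationAt_cotangentBundle_snd hb]
  simp only [PartialEquiv.trans_apply, PartialEquiv.prod_coe, PartialEquiv.refl_coe]
  have hbase : b.proj ∈
      (trivializationAt (E →L[ℝ] ℝ) (CotangentSpace I : M → Type _) a.proj).baseSet := by
    simpa [hom_trivializationAt_baseSet] using hb
  exact Prod.ext (congrArg (extChartAt I a.proj) (Trivialization.coe_fst' _ hbase)) rfl

theorem mem_extChartAt_cotangentBundle_source {a b : CotangentBundle I M} :
    b ∈ (extChartAt (cotangentModel E I) a).source ↔ b.proj ∈ (extChartAt I a.proj).source := by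
  rw [extChartAt_source, extChartAt_source, FiberBundle.chartedSpace_chartAt]
  simp +contextual

theorem contMDiffAt_cotangentBundle_iff {E' : Type*} [NormedAddCommGroup E'] [NormedSpace ℝ E']
    {H' : Type*} [TopologicalSpace H'] {I' : ModelWithCorners ℝ E' H'}
    {N : Type*} [TopologicalSpace N] [ChartedSpace H' N]
    {n : WithTop ℕ∞} {f : N → CotangentBundle I M} {x : N} :
    ContMDiffAt I' (cotangentModel E I) n f x ↔
      ContMDiffAt I' I n (fun y => (f y).proj) x ∧
      ContMDiffAt I' 𝓘(ℝ, E →L[ℝ] ℝ) n (fun y => covectorCoord I (f x).proj (f y)) x := by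
  rw [contMDiffAt_totalSpace]
  refine and_congr_right fun h => ?_
  have hsource : ∀ᶠ y in 𝓝 x, (f y).proj ∈ (extChartAt I (f x).proj).source :=
    h.continuousAt (extChartAt_source_mem_nhds _)
  exact EventuallyEq.contMDiffAt_iff
    (hsource.mono fun y hy => trivializationAt_cotangentBundle_snd hy)

theorem contMDiffAt_covectorCoord {n : WithTop ℕ∞} (b : CotangentBundle I M) :
    ContMDiffAt (cotangentModel E I) 𝓘(ℝ, E →L[ℝ] ℝ) n (covectorCoord I b.proj) b :=
  (contMDiffAt_cotangentBundle_iff.1 (contMDiffAt_id (x := b) (I := cotangentModel E I))).2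

end Covectors

section CoordinateChanges

variable {E : Type*} [NormedAddCommGroup E] [NormedSpace ℝ E]
  {H : Type*} [TopologicalSpace H] {I : ModelWithCorners ℝ E H} [I.Boundaryless]
  {M : Type*} [TopologicalSpace M] [ChartedSpace H M] [IsManifold I 1 M]

theorem tangentBundle_transition {a a₀ b : TangentBundle I M}
    (ha : b.proj ∈ (extChartAt I a.proj).source) (ha₀ : b.proj ∈ (extChartAt I a₀.proj).source) :
    extChartAt I.tangent a₀ ∘ (extChartAt I.tangent a).symm
      =ᶠ[𝓝 (extChartAt I.tangent a b)]
        tangentTransition (extChartAt I a₀.proj ∘ (extChartAt I a.proj).symm) := by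
  refine eventuallyEq_extChartAt_comp_symm (mem_extChartAt_tangentBundle_source.2 ha)
    (mem_extChartAt_tangentBundle_source.2 ha₀) fun c hc hc₀ => ?_
  rw [mem_extChartAt_tangentBundle_source] at hc hc₀
  rw [extChartAt_tangentBundle_apply, extChartAt_tangentBundle_apply, tangentTransition,
    ← tangentCoordChange_eq_fderiv, Function.comp_apply, (extChartAt I a.proj).left_inv hc]
  exact Prod.ext rfl (tangentCoordChange_comp (I := I) ⟨⟨mem_extChartAt_source _, hc⟩, hc₀⟩)

theorem cotangentBundle_transition {a a₀ b : CotangentBundle I M}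
    (ha : b.proj ∈ (extChartAt I a.proj).source) (ha₀ : b.proj ∈ (extChartAt I a₀.proj).source) :
    extChartAt (cotangentModel E I) a₀ ∘ (extChartAt (cotangentModel E I) a).symm
      =ᶠ[𝓝 (extChartAt (cotangentModel E I) a b)]
        cotangentTransition (extChartAt I a₀.proj ∘ (extChartAt I a.proj).symm) := by
  refine eventuallyEq_extChartAt_comp_symm (mem_extChartAt_cotangentBundle_source.2 ha)
    (mem_extChartAt_cotangentBundle_source.2 ha₀) fun c hc hc₀ => ?_
  rw [mem_extChartAt_cotangentBundle_source] at hc hc₀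
  rw [extChartAt_cotangentBundle_apply hc, extChartAt_cotangentBundle_apply hc₀,
    cotangentTransition, ← tangentCoordChange_eq_fderiv, inverse_tangentCoordChange hc hc₀,
    covectorCoord_comp_tangentCoordChange hc hc₀, Function.comp_apply,
    (extChartAt I a.proj).left_inv hc]

end CoordinateChanges

section Alpha

variable {E : Type*} [NormedAddCommGroup E] [NormedSpace ℝ E]
  {H : Type*} [TopologicalSpace H] {I : ModelWithCorners ℝ E H}
  {M : Type*} [TopologicalSpace M] [ChartedSpace H M]

/-- The components of a tangent vector in the chart of `M` at `x₀`. -/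
def vectorCoord (I : ModelWithCorners ℝ E H) [IsManifold I 1 M] (x₀ : M)
    (X : TangentBundle I M) : E :=
  tangentCoordChange I X.proj x₀ X.proj X.snd

theorem vectorCoord_self [IsManifold I 1 M] (X : TangentBundle I M) :
    vectorCoord I X.proj X = X.snd :=
  tangentCoordChange_self (mem_extChartAt_source _)

theorem contMDiffAt_vectorCoord {n : WithTop ℕ∞} [IsManifold I 1 M] (X : TangentBundle I M) :
    ContMDiffAt I.tangent 𝓘(ℝ, E) n (vectorCoord I X.proj) X :=
  (contMDiffAt_totalSpace.1 (contMDiffAt_id (x := X) (I := I.tangent))).2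

theorem hasMFDerivAt_cotangentBundle_proj [IsManifold I 1 M] (a : CotangentBundle I M) :
    HasMFDerivAt (cotangentModel E I) I TotalSpace.proj a
      (ContinuousLinearMap.fst ℝ E (E →L[ℝ] ℝ)) := by
  have hmem : extChartAt (cotangentModel E I) a a ∈ range (cotangentModel E I) := mem_range_self _
  have hfst : writtenInExtChartAt (cotangentModel E I) I a TotalSpace.proj
      =ᶠ[𝓝[range (cotangentModel E I)] extChartAt (cotangentModel E I) a a] Prod.fst := by
    filter_upwards [extChartAt_target_mem_nhdsWithin (I := cotangentModel E I) a] with e he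
    have hsource := mem_extChartAt_cotangentBundle_source.1
      ((extChartAt (cotangentModel E I) a).map_target he)
    exact congrArg Prod.fst ((extChartAt_cotangentBundle_apply hsource).symm.trans
      ((extChartAt (cotangentModel E I) a).right_inv he))
  exact ⟨(contMDiff_proj (n := 0) (IB := I) (F := E →L[ℝ] ℝ)
      (E := (CotangentSpace I : M → Type _))).continuous.continuousAt,
    hasFDerivWithinAt_fst.congr_of_eventuallyEq hfst (hfst.self_of_nhdsWithin hmem)⟩

variable [IsManifold I ∞ M]

theorem alpha_proj_eq_tangentMap (X : TangentBundle (cotangentModel E I) (CotangentBundle I M)) :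
    (alpha I X).proj = tangentMap (cotangentModel E I) I TotalSpace.proj X :=
  congrArg (TotalSpace.mk X.proj.proj)
    (DFunLike.congr_fun (hasMFDerivAt_cotangentBundle_proj X.proj).mfderiv X.snd).symm

theorem contMDiff_alpha_proj :
    ContMDiff (cotangentModel E I).tangent I.tangent ∞
      fun X : TangentBundle (cotangentModel E I) (CotangentBundle I M) => (alpha I X).proj := by
  simp only [alpha_proj_eq_tangentMap]
  exact (contMDiff_proj (n := ∞) _).contMDiff_tangentMap (by simp)

variable [I.Boundaryless]

theorem contDiffAt_transition {x₀ x : M} (hx : x ∈ (extChartAt I x₀).source) :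
    ContDiffAt ℝ 2 (extChartAt I x₀ ∘ (extChartAt I x).symm) (extChartAt I x x) :=
  (contDiffAt_chart_comp (n := ∞) (F := id) contMDiffAt_id (mem_extChartAt_source x) hx).of_le
    (WithTop.coe_le_coe.2 le_top)

theorem vectorCoord_cotangentBundle {a₀ : CotangentBundle I M}
    {X : TangentBundle (cotangentModel E I) (CotangentBundle I M)}
    (hX : X.proj.proj ∈ (extChartAt I a₀.proj).source) :
    vectorCoord (cotangentModel E I) a₀ X =
      fderiv ℝ (cotangentTransition (extChartAt I a₀.proj ∘ (extChartAt I X.proj.proj).symm))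
        (extChartAt I X.proj.proj X.proj.proj, X.proj.snd) X.snd := by
  have h := mem_extChartAt_source (I := I) X.proj.proj
  rw [vectorCoord, tangentCoordChange_eq_fderiv, (cotangentBundle_transition h hX).fderiv_eq,
    extChartAt_cotangentBundle_apply h, covectorCoord_self]

theorem tangentCoordChange_tangentBundle {ξ₀ ξ : TangentBundle I M}
    (hξ : ξ.proj ∈ (extChartAt I ξ₀.proj).source) :
    tangentCoordChange I.tangent ξ ξ₀ ξ =
      fderiv ℝ (tangentTransition (extChartAt I ξ₀.proj ∘ (extChartAt I ξ.proj).symm))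
        (extChartAt I ξ.proj ξ.proj, ξ.snd) := by
  have h := mem_extChartAt_source (I := I) ξ.proj
  rw [tangentCoordChange_eq_fderiv, (tangentBundle_transition h hξ).fderiv_eq,
    extChartAt_tangentBundle_apply, tangentCoordChange_self_eq_id h]
  rfl

variable [CompleteSpace E]

theorem covectorCoord_alpha {a₀ : CotangentBundle I M} {ξ₀ : TangentBundle I M}
    (h₀ : a₀.proj = ξ₀.proj)
    {X : TangentBundle (cotangentModel E I) (CotangentBundle I M)}
    (hX : X.proj.proj ∈ (extChartAt I a₀.proj).source) :
    covectorCoord I.tangent ξ₀ (alpha I X) =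
      ContinuousLinearMap.coprod (vectorCoord (cotangentModel E I) a₀ X).2
        (covectorCoord I a₀.proj X.proj) := by
  have h := mem_extChartAt_source (I := I) X.proj.proj
  have hξ₀ : (alpha I X).proj.proj ∈ (extChartAt I ξ₀.proj).source := h₀ ▸ hX
  have hinv : (fderiv ℝ (extChartAt I a₀.proj ∘ (extChartAt I X.proj.proj).symm)
      (extChartAt I X.proj.proj X.proj.proj)).IsInvertible := by
    rw [← tangentCoordChange_eq_fderiv]
    exact isInvertible_tangentCoordChange h hX
  have hpairing : ContinuousLinearMap.coprod (vectorCoord (cotangentModel E I) a₀ X).2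
        (covectorCoord I a₀.proj X.proj) ∘L
      tangentCoordChange I.tangent (alpha I X).proj ξ₀ (alpha I X).proj = (alpha I X).snd := by
    rw [tangentCoordChange_tangentBundle hξ₀, ← h₀, vectorCoord_cotangentBundle hX, covectorCoord,
      ← inverse_tangentCoordChange h hX, tangentCoordChange_eq_fderiv]
    exact ContinuousLinearMap.ext
      (pairing_transition (contDiffAt_transition hX) hinv X.proj.snd X.snd)
  rw [covectorCoord, ← hpairing]
  refine (ContinuousLinearMap.comp_assoc _ _ _).trans ?_
  exact (congrArg (ContinuousLinearMap.comp _) (tangentCoordChange_comp_symm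
    (mem_extChartAt_source _) (mem_extChartAt_tangentBundle_source.2 hξ₀))).trans
    (ContinuousLinearMap.comp_id _)

theorem contMDiff_alpha :
    ContMDiff (cotangentModel E I).tangent (cotangentModel (E × E) I.tangent) ∞
      (alpha I : _ → CotangentBundle I.tangent (TangentBundle I M)) := by
  intro X₀
  have hbase : ContMDiffAt (cotangentModel E I).tangent (cotangentModel E I) ∞
      (fun X : TangentBundle (cotangentModel E I) (CotangentBundle I M) => X.proj) X₀ :=
    contMDiffAt_proj _
  have hsource : ∀ᶠ X in 𝓝 X₀, X.proj.proj ∈ (extChartAt I X₀.proj.proj).source :=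
    ((contMDiffAt_proj _).comp X₀ hbase).continuousAt (extChartAt_source_mem_nhds _)
  have hvector : ContMDiffAt _ 𝓘(ℝ, E →L[ℝ] ℝ) ∞ (fun X => (vectorCoord _ X₀.proj X).2) X₀ :=
    contDiff_snd.contMDiff.contMDiffAt.comp X₀ (contMDiffAt_vectorCoord X₀)
  have hcovector : ContMDiffAt _ 𝓘(ℝ, E →L[ℝ] ℝ) ∞
      (fun X => covectorCoord I X₀.proj.proj X.proj) X₀ :=
    (contMDiffAt_covectorCoord X₀.proj).comp X₀ hbase
  have h := (hvector.clm_comp (contMDiffAt_const (c := ContinuousLinearMap.fst ℝ E E))).add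
    (hcovector.clm_comp (contMDiffAt_const (c := ContinuousLinearMap.snd ℝ E E)))
  refine contMDiffAt_cotangentBundle_iff.2 ⟨contMDiff_alpha_proj X₀, ?_⟩
  refine h.congr_of_eventuallyEq (hsource.mono fun X hX => ?_)
  exact (covectorCoord_alpha (ξ₀ := (alpha I X₀).proj) rfl hX).trans (by ext <;> simp)

end Alpha

section Hat

variable {E : Type*} [NormedAddCommGroup E] [NormedSpace ℝ E]
  {H : Type*} [TopologicalSpace H] {I : ModelWithCorners ℝ E H}
  {M : Type*} [TopologicalSpace M] [ChartedSpace H M]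
  {E' : Type*} [NormedAddCommGroup E'] [NormedSpace ℝ E']
  {H' : Type*} [TopologicalSpace H'] {I' : ModelWithCorners ℝ E' H'}
  {M' : Type*} [TopologicalSpace M'] [ChartedSpace H' M'] {F : M → M'}

theorem covectorCoord_hat [IsManifold I 1 M] [IsManifold I' 1 M'] {x₀ : M} {y₀ : M'}
    {b : CotangentBundle I M} (hx : b.proj ∈ (extChartAt I x₀).source)
    (hy : F b.proj ∈ (extChartAt I' y₀).source) :
    covectorCoord I' y₀ (hat I I' F b) =
      covectorCoord I x₀ b ∘L (derivCoord I I' F x₀ y₀ b.proj).inverse := by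
  have hcancel := covectorCoord_comp_tangentCoordChange hx (mem_extChartAt_source (I := I) b.proj)
  rw [covectorCoord_self] at hcancel
  rw [inverse_derivCoord hx hy, ← ContinuousLinearMap.comp_assoc, hcancel]
  rfl

variable [IsManifold I ∞ M] [IsManifold I' ∞ M'] [CompleteSpace E]

theorem isOpen_setOf_isInvertible_mfderiv {U : Set M} (hU : IsOpen U)
    (hF : ContMDiffOn I I' ∞ F U) : IsOpen {x | x ∈ U ∧ (mfderiv I I' F x).IsInvertible} := by
  rw [isOpen_iff_mem_nhds]
  rintro x ⟨hx, hi⟩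
  have hFx := hF.contMDiffAt (hU.mem_nhds hx)
  have hFsource : ∀ᶠ y in 𝓝 x, F y ∈ (extChartAt I' (F x)).source :=
    hFx.continuousAt (extChartAt_source_mem_nhds _)
  have hinv : ∀ᶠ y in 𝓝 x, (derivCoord I I' F x (F x) y).IsInvertible :=
    eventually_isInvertible (contMDiffAt_derivCoord (m := ∞) hFx (by simp)).continuousAt
      ((isInvertible_derivCoord_iff (mem_extChartAt_source _) (mem_extChartAt_source _)).2 hi)
  filter_upwards [hU.mem_nhds hx, extChartAt_source_mem_nhds (I := I) x, hFsource, hinv]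
    with y hyU hy hFy hy_inv
  exact ⟨hyU, (isInvertible_derivCoord_iff hy hFy).1 hy_inv⟩

theorem contMDiffAt_hat {b : CotangentBundle I M} (hF : ContMDiffAt I I' ∞ F b.proj)
    (hi : (mfderiv I I' F b.proj).IsInvertible) :
    ContMDiffAt (cotangentModel E I) (cotangentModel E' I') ∞ (hat I I' F) b := by
  have hproj : ContMDiffAt (cotangentModel E I) I ∞ (fun c : CotangentBundle I M => c.proj) b :=
    contMDiffAt_proj _
  have hFproj : ContMDiffAt (cotangentModel E I) I' ∞
      (fun c : CotangentBundle I M => F c.proj) b := hF.comp b hproj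
  have hinv : (derivCoord I I' F b.proj (F b.proj) b.proj).IsInvertible :=
    (isInvertible_derivCoord_iff (mem_extChartAt_source _) (mem_extChartAt_source _)).2 hi
  have hinverse := (hinv.contDiffAt_map_inverse (n := ∞)).contMDiffAt.comp b
    ((contMDiffAt_derivCoord (m := ∞) hF (by simp)).comp b hproj)
  refine contMDiffAt_cotangentBundle_iff.2
    ⟨hFproj, ((contMDiffAt_covectorCoord b).clm_comp hinverse).congr_of_eventuallyEq ?_⟩
  filter_upwards [hproj.continuousAt (extChartAt_source_mem_nhds (I := I) b.proj),
    hFproj.continuousAt (extChartAt_source_mem_nhds (I := I') (F b.proj))] with c hc hFc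
  exact covectorCoord_hat hc hFc

end Hat

section Phi

variable {E : Type*} [NormedAddCommGroup E] [NormedSpace ℝ E]
  {H : Type*} [TopologicalSpace H] {I : ModelWithCorners ℝ E H}
  {M : Type*} [TopologicalSpace M] [ChartedSpace H M] [IsManifold I 1 M]

theorem covectorCoord_Phi_symm_fst {y : M × M} {b : CotangentBundle (I.prod I) (M × M)}
    (hb : b.proj ∈ (extChartAt (I.prod I) y).source) :
    covectorCoord I y.1 ((Phi I).symm b).1 = -(covectorCoord (I.prod I) y b ∘L .inl ℝ E E) := by
  rw [covectorCoord, covectorCoord, tangentCoordChange_prod hb (mem_extChartAt_source _)]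
  ext v
  have hv : (tangentCoordChange I y.1 b.proj.1 b.proj.1 v, (0 : E)) =
      (tangentCoordChange I y.1 b.proj.1 b.proj.1 v,
        tangentCoordChange I y.2 b.proj.2 b.proj.2 0) := by rw [map_zero]
  exact congrArg (fun z => -(b.snd : E × E →L[ℝ] ℝ) z) hv

theorem covectorCoord_Phi_symm_snd {y : M × M} {b : CotangentBundle (I.prod I) (M × M)}
    (hb : b.proj ∈ (extChartAt (I.prod I) y).source) :
    covectorCoord I y.2 ((Phi I).symm b).2 = covectorCoord (I.prod I) y b ∘L .inr ℝ E E := by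
  rw [covectorCoord, covectorCoord, tangentCoordChange_prod hb (mem_extChartAt_source _)]
  ext v
  have hv : ((0 : E), tangentCoordChange I y.2 b.proj.2 b.proj.2 v) =
      (tangentCoordChange I y.1 b.proj.1 b.proj.1 0,
        tangentCoordChange I y.2 b.proj.2 b.proj.2 v) := by rw [map_zero]
  exact congrArg (b.snd : E × E →L[ℝ] ℝ) hv

theorem contMDiff_Phi_symm {n : WithTop ℕ∞} :
    ContMDiff (cotangentModel (E × E) (I.prod I)) ((cotangentModel E I).prod (cotangentModel E I))
      n ((Phi I).symm : CotangentBundle (I.prod I) (M × M) → _) := by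
  intro b
  have hproj : ContMDiffAt (cotangentModel (E × E) (I.prod I)) (I.prod I) n
      (fun c : CotangentBundle (I.prod I) (M × M) => c.proj) b := contMDiffAt_proj _
  have hsource : ∀ᶠ c : CotangentBundle (I.prod I) (M × M) in 𝓝 b,
      c.proj ∈ (extChartAt (I.prod I) b.proj).source :=
    hproj.continuousAt (extChartAt_source_mem_nhds _)
  have hcomp (A : E →L[ℝ] E × E) :=
    (contMDiffAt_covectorCoord (n := n) b).clm_comp (contMDiffAt_const (c := A))
  exact ContMDiffAt.prodMk
    (contMDiffAt_cotangentBundle_iff.2 ⟨hproj.fst, (hcomp (.inl ℝ E E)).neg.congr_of_eventuallyEq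
      (hsource.mono fun c hc => covectorCoord_Phi_symm_fst hc)⟩)
    (contMDiffAt_cotangentBundle_iff.2 ⟨hproj.snd, (hcomp (.inr ℝ E E)).congr_of_eventuallyEq
      (hsource.mono fun c hc => covectorCoord_Phi_symm_snd hc)⟩)

end Phi

section Fiber

variable {E : Type*} [NormedAddCommGroup E] [NormedSpace ℝ E]
  {H : Type*} [TopologicalSpace H] {I : ModelWithCorners ℝ E H}
  {M : Type*} [TopologicalSpace M] [ChartedSpace H M] [IsManifold I 1 M]

theorem contMDiff_fiber_inclusion (x : M) {n : WithTop ℕ∞} :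
    ContMDiff 𝓘(ℝ, E) I.tangent n (fun u : E => (⟨x, u⟩ : TangentBundle I M)) := by
  intro u
  refine contMDiffAt_totalSpace.2 ⟨contMDiffAt_const, ?_⟩
  refine contMDiffAt_id.congr_of_eventuallyEq (.of_forall fun v => ?_)
  exact tangentCoordChange_self (mem_extChartAt_source x)

theorem hasFDerivAt_extChartAt_comp {V : Type*} [NormedAddCommGroup V] [NormedSpace ℝ V]
    {g : V → M} {u : V} {x₀ x : M} (hg : MDifferentiableAt 𝓘(ℝ, V) I g u) (hu : g u = x)
    (hx : x ∈ (extChartAt I x₀).source) :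
    HasFDerivAt (fun v => extChartAt I x₀ (g v))
      (tangentCoordChange I x x₀ x ∘L (mfderiv 𝓘(ℝ, V) I g u : V →L[ℝ] E)) u := by
  subst hu
  rw [extChartAt_source] at hx
  have hchart := hasMFDerivAt_extChartAt (I := I) hx
  rw [mfderiv_chartAt_eq_tangentCoordChange hx] at hchart
  exact (hchart.comp u hg.hasMFDerivAt).hasFDerivAt

theorem hasFDerivAt_extChartAt_fiber {f : TangentBundle I M → M} {x₀ x : M}
    (hf : MDifferentiableAt I.tangent I f ⟨x, 0⟩) (h₀ : f ⟨x, 0⟩ = x)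
    (hx : x ∈ (extChartAt I x₀).source) :
    HasFDerivAt (fun u : E => extChartAt I x₀ (f ⟨x, u⟩))
      (tangentCoordChange I x x₀ x ∘L fiberDeriv I f x) 0 := by
  have hfiber : MDifferentiableAt 𝓘(ℝ, E) I (fun u : E => f ⟨x, u⟩) 0 :=
    hf.comp (0 : E) ((contMDiff_fiber_inclusion x (n := 1)).mdifferentiableAt one_ne_zero)
  exact hasFDerivAt_extChartAt_comp hfiber h₀ hx

theorem hasFDerivAt_extChartAt_prod_fiber {R : TangentBundle I M → M × M} {x₀ x : M}
    (hR : MDifferentiableAt I.tangent (I.prod I) R ⟨x, 0⟩) (h₀ : R ⟨x, 0⟩ = (x, x))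
    (hx : x ∈ (extChartAt I x₀).source) :
    HasFDerivAt (fun u : E => extChartAt (I.prod I) (x₀, x₀) (R ⟨x, u⟩))
      ((tangentCoordChange I x x₀ x ∘L fiberDeriv I (fun ξ => (R ξ).1) x).prod
        (tangentCoordChange I x x₀ x ∘L fiberDeriv I (fun ξ => (R ξ).2) x)) 0 := by
  rw [extChartAt_prod]
  exact (hasFDerivAt_extChartAt_fiber hR.fst (congrArg Prod.fst h₀) hx).prodMk
    (hasFDerivAt_extChartAt_fiber hR.snd (congrArg Prod.snd h₀) hx)

namespace IsDiscretizationMap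

variable {U : Set (TangentBundle I M)} {R : TangentBundle I M → M × M}

theorem contMDiffAt (hR : IsDiscretizationMap I U R) {ξ : TangentBundle I M} (hξ : ξ ∈ U) :
    ContMDiffAt I.tangent (I.prod I) ∞ R ξ :=
  hR.contMDiffOn.contMDiffAt (hR.isOpen_domain.mem_nhds hξ)

theorem mdifferentiableAt (hR : IsDiscretizationMap I U R) {ξ : TangentBundle I M} (hξ : ξ ∈ U) :
    MDifferentiableAt I.tangent (I.prod I) R ξ :=
  (hR.contMDiffAt hξ).mdifferentiableAt (by simp)

end IsDiscretizationMap

end Fiber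

section ChartMap

variable {E : Type*} [NormedAddCommGroup E] [NormedSpace ℝ E]
  {H : Type*} [TopologicalSpace H] {I : ModelWithCorners ℝ E H}
  {M : Type*} [TopologicalSpace M] [ChartedSpace H M] [IsManifold I 1 M]

variable (I) in
/-- The expression of `R : TM → M × M` in the charts induced by the chart of `M` at `q`. -/
def chartMap (R : TangentBundle I M → M × M) (q : M) : E × E → E × E :=
  extChartAt (I.prod I) (q, q) ∘ R ∘ (extChartAt I.tangent (⟨q, 0⟩ : TangentBundle I M)).symm

variable {R : TangentBundle I M → M × M} {q y : M}

theorem extChartAt_tangentBundle_fiber (hy : y ∈ (extChartAt I q).source) (v : E) :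
    extChartAt I.tangent (⟨q, 0⟩ : TangentBundle I M) ⟨y, tangentCoordChange I q y y v⟩ =
      (extChartAt I q y, v) := by
  rw [extChartAt_tangentBundle_apply]
  exact Prod.ext rfl (DFunLike.congr_fun
    (tangentCoordChange_comp_symm (mem_extChartAt_source (I := I) y) hy) v)

theorem extChartAt_tangentBundle_zero (hy : y ∈ (extChartAt I q).source) :
    extChartAt I.tangent (⟨q, 0⟩ : TangentBundle I M) ⟨y, 0⟩ = (extChartAt I q y, 0) := by
  rw [← extChartAt_tangentBundle_fiber hy, map_zero]
  rfl

theorem chartMap_apply (hy : y ∈ (extChartAt I q).source) (v : E) :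
    chartMap I R q (extChartAt I q y, v) =
      extChartAt (I.prod I) (q, q) (R ⟨y, tangentCoordChange I q y y v⟩) := by
  rw [← extChartAt_tangentBundle_fiber hy, chartMap, Function.comp_apply, Function.comp_apply,
    PartialEquiv.left_inv _ (mem_extChartAt_tangentBundle_source.2 hy)]

theorem chartMap_zero (hy : y ∈ (extChartAt I q).source) (h₀ : R ⟨y, 0⟩ = (y, y)) :
    chartMap I R q (extChartAt I q y, 0) = (extChartAt I q y, extChartAt I q y) := by
  rw [chartMap_apply hy, map_zero, extChartAt_prod]
  exact congrArg ((extChartAt I q).prod (extChartAt I q)) h₀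

end ChartMap

section Lift

variable {E : Type*} [NormedAddCommGroup E] [NormedSpace ℝ E]
  {H : Type*} [TopologicalSpace H] {I : ModelWithCorners ℝ E H}
  {M : Type*} [TopologicalSpace M] [ChartedSpace H M] [IsManifold I ∞ M]
  {U : Set (TangentBundle I M)} {R : TangentBundle I M → M × M}

theorem isOpen_cotangentLiftDomain [CompleteSpace E] (hU : IsOpen U)
    (hR : ContMDiffOn I.tangent (I.prod I) ∞ R U) : IsOpen (cotangentLiftDomain I U R) :=
  (isOpen_setOf_isInvertible_mfderiv hU hR).preimage contMDiff_alpha_proj.continuous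

variable [I.Boundaryless]

theorem hasFDerivAt_chartMap {q : M} {ξ : TangentBundle I M}
    (hR : MDifferentiableAt I.tangent (I.prod I) R ξ) (hξ : ξ.proj ∈ (extChartAt I q).source)
    (hRξ : R ξ ∈ (extChartAt (I.prod I) (q, q)).source) :
    HasFDerivAt (chartMap I R q) (derivCoord I.tangent (I.prod I) R ⟨q, 0⟩ (q, q) ξ)
      (extChartAt I.tangent (⟨q, 0⟩ : TangentBundle I M) ξ) :=
  hasFDerivAt_chart_comp hR (mem_extChartAt_tangentBundle_source.2 hξ) hRξ

theorem fderiv_chartMap_sub (hR : IsDiscretizationMap I U R) {q y : M}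
    (hy : y ∈ (extChartAt I q).source) (v : E) :
    (fderiv ℝ (chartMap I R q) (extChartAt I q y, 0) (0, v)).2 -
      (fderiv ℝ (chartMap I R q) (extChartAt I q y, 0) (0, v)).1 = v := by
  have hRy := hR.mdifferentiableAt (hR.zero_mem y)
  have hRsource : R ⟨y, 0⟩ ∈ (extChartAt (I.prod I) (q, q)).source := by
    rw [hR.map_zero, extChartAt_prod]
    exact ⟨hy, hy⟩
  have hchart := (hasFDerivAt_chartMap (q := q) hRy hy hRsource).differentiableAt
  rw [extChartAt_tangentBundle_zero hy] at hchart
  have hfiber : HasFDerivAt (fun u => chartMap I R q (extChartAt I q y, u)) _ 0 :=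
    hchart.hasFDerivAt.comp (0 : E) (hasFDerivAt_prodMk_right (extChartAt I q y) (0 : E))
  have hR' := hasFDerivAt_extChartAt_prod_fiber hRy (hR.map_zero y) hy
  rw [← map_zero (tangentCoordChange I q y y)] at hR'
  have hfiber' := hR'.comp (0 : E) (tangentCoordChange I q y y).hasFDerivAt
  have hderiv := DFunLike.congr_fun
    (hfiber.unique (hfiber'.congr_of_eventuallyEq (.of_forall (chartMap_apply hy)))) v
  have hsub := DFunLike.congr_fun (hR.fiberDeriv_sub y) (tangentCoordChange I q y y v)
  have hcancel := DFunLike.congr_fun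
    (tangentCoordChange_comp_symm (mem_extChartAt_source (I := I) y) hy) v
  calc
    _ = tangentCoordChange I y q y (fiberDeriv I (fun ξ => (R ξ).2) y
          (tangentCoordChange I q y y v)) - tangentCoordChange I y q y
          (fiberDeriv I (fun ξ => (R ξ).1) y (tangentCoordChange I q y y v)) :=
      congrArg (fun z : E × E => z.2 - z.1) hderiv
    _ = v := by
      rw [← map_sub]
      exact (congrArg (tangentCoordChange I y q y) hsub).trans hcancel

theorem isLocalDiscretization_chartMap (hR : IsDiscretizationMap I U R) (q : M) :
    IsLocalDiscretization (chartMap I R q) (extChartAt I q q) where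
  contDiffAt := by
    rw [← extChartAt_tangentBundle_zero (mem_extChartAt_source q)]
    refine (contDiffAt_chart_comp (n := ∞) (hR.contMDiffAt (hR.zero_mem q))
      (mem_extChartAt_source _) ?_).of_le (WithTop.coe_le_coe.2 le_top)
    rw [hR.map_zero]
    exact mem_extChartAt_source _
  map_zero := eventually_extChartAt fun y hy => chartMap_zero hy (hR.map_zero y)
  fderiv_sub := eventually_extChartAt fun _ hy => fderiv_chartMap_sub hR hy

theorem isInvertible_mfderiv_zero (hR : IsDiscretizationMap I U R) (q : M) :
    (mfderiv I.tangent (I.prod I) R (⟨q, 0⟩ : TangentBundle I M)).IsInvertible := by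
  have hq := mem_extChartAt_source (I := I) q
  have hRsource : R ⟨q, 0⟩ ∈ (extChartAt (I.prod I) (q, q)).source := by
    rw [hR.map_zero]
    exact mem_extChartAt_source _
  have hderiv := (hasFDerivAt_chartMap (hR.mdifferentiableAt (hR.zero_mem q)) hq hRsource).fderiv
  rw [extChartAt_tangentBundle_zero hq] at hderiv
  rw [← isInvertible_derivCoord_iff (mem_extChartAt_source _) hRsource, ← hderiv]
  exact (isLocalDiscretization_chartMap hR q).isInvertible_fderiv

theorem zero_mem_cotangentLiftDomain (hR : IsDiscretizationMap I U R) (a : CotangentBundle I M) :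
    (⟨a, 0⟩ : TangentBundle (cotangentModel E I) (CotangentBundle I M)) ∈
      cotangentLiftDomain I U R :=
  ⟨hR.zero_mem a.proj, isInvertible_mfderiv_zero hR a.proj⟩

variable [CompleteSpace E]

theorem contMDiffOn_cotangentLift (hU : IsOpen U)
    (hR : ContMDiffOn I.tangent (I.prod I) ∞ R U) :
    ContMDiffOn (cotangentModel E I).tangent ((cotangentModel E I).prod (cotangentModel E I)) ∞
      (cotangentLift I R) (cotangentLiftDomain I U R) := by
  rintro X ⟨hX, hi⟩
  have hhat := contMDiffAt_hat (hR.contMDiffAt (hU.mem_nhds hX)) hi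
  exact ((contMDiff_Phi_symm _).comp X (hhat.comp X (contMDiff_alpha X))).contMDiffWithinAt

theorem covectorCoord_hat_alpha {a : CotangentBundle I M} {w : E × (E →L[ℝ] ℝ)}
    (hR : MDifferentiableAt I.tangent (I.prod I) R ⟨a.proj, w.1⟩)
    (hw : R ⟨a.proj, w.1⟩ ∈ (extChartAt (I.prod I) (a.proj, a.proj)).source) :
    covectorCoord (I.prod I) (a.proj, a.proj) (hat I.tangent (I.prod I) R
      (alpha I (⟨a, w⟩ : TangentBundle (cotangentModel E I) (CotangentBundle I M)))) =
      momentum (chartMap I R a.proj) (extChartAt I a.proj a.proj) a.snd w := by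
  have ha := mem_extChartAt_source (I := I) a.proj
  have hα : covectorCoord I.tangent (⟨a.proj, 0⟩ : TangentBundle I M)
      (alpha I (⟨a, w⟩ : TangentBundle (cotangentModel E I) (CotangentBundle I M))) =
      ContinuousLinearMap.coprod w.2 a.snd := by
    refine (covectorCoord_alpha (a₀ := a) rfl ha).trans ?_
    rw [covectorCoord_self]
    exact congrArg (fun u : E × (E →L[ℝ] ℝ) => ContinuousLinearMap.coprod u.2 a.snd)
      (vectorCoord_self _)
  have hz : extChartAt I.tangent (⟨a.proj, 0⟩ : TangentBundle I M) ⟨a.proj, w.1⟩ =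
      (extChartAt I a.proj a.proj, w.1) := by
    rw [← extChartAt_tangentBundle_fiber ha, tangentCoordChange_self ha]
  have hderiv := (hasFDerivAt_chartMap hR ha hw).fderiv
  rw [hz] at hderiv
  refine (covectorCoord_hat (x₀ := (⟨a.proj, 0⟩ : TangentBundle I M))
    (mem_extChartAt_tangentBundle_source.2 ha) hw).trans ?_
  rw [hα]
  exact congrArg (fun A : E × E →L[ℝ] E × E => ContinuousLinearMap.coprod w.2 a.snd ∘L A.inverse)
    hderiv.symm

theorem extChartAt_cotangentLift {a : CotangentBundle I M} {w : E × (E →L[ℝ] ℝ)}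
    (hR : MDifferentiableAt I.tangent (I.prod I) R ⟨a.proj, w.1⟩)
    (hw : R ⟨a.proj, w.1⟩ ∈ (extChartAt (I.prod I) (a.proj, a.proj)).source) :
    extChartAt ((cotangentModel E I).prod (cotangentModel E I)) (a, a)
        (cotangentLift I R ⟨a, w⟩) =
      localLift (chartMap I R a.proj) (extChartAt I a.proj a.proj) a.snd w := by
  have ha := mem_extChartAt_source (I := I) a.proj
  have hbase : chartMap I R a.proj (extChartAt I a.proj a.proj, w.1) =
      extChartAt (I.prod I) (a.proj, a.proj) (R ⟨a.proj, w.1⟩) := by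
    rw [chartMap_apply ha, tangentCoordChange_self ha]
  have hmomentum := covectorCoord_hat_alpha hR hw
  have hfst := covectorCoord_Phi_symm_fst (y := (a.proj, a.proj)) (b := hat I.tangent (I.prod I) R
    (alpha I (⟨a, w⟩ : TangentBundle (cotangentModel E I) (CotangentBundle I M)))) hw
  have hsnd := covectorCoord_Phi_symm_snd (y := (a.proj, a.proj)) (b := hat I.tangent (I.prod I) R
    (alpha I (⟨a, w⟩ : TangentBundle (cotangentModel E I) (CotangentBundle I M)))) hw
  rw [hmomentum] at hfst hsnd
  rw [extChartAt_prod] at hw hbase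
  rw [extChartAt_prod]
  exact Prod.ext
    ((extChartAt_cotangentBundle_apply (b := (cotangentLift I R ⟨a, w⟩).1) hw.1).trans
      (Prod.ext (congrArg Prod.fst hbase).symm hfst))
    ((extChartAt_cotangentBundle_apply (b := (cotangentLift I R ⟨a, w⟩).2) hw.2).trans
      (Prod.ext (congrArg Prod.snd hbase).symm hsnd))

theorem cotangentLift_zero (hR : IsDiscretizationMap I U R) (a : CotangentBundle I M) :
    cotangentLift I R ⟨a, 0⟩ = (a, a) := by
  have ha := mem_extChartAt_source (I := I) a.proj
  have hRsource : R ⟨a.proj, 0⟩ ∈ (extChartAt (I.prod I) (a.proj, a.proj)).source := by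
    rw [hR.map_zero]
    exact mem_extChartAt_source _
  have hself : extChartAt (cotangentModel E I) a a = (extChartAt I a.proj a.proj, a.snd) := by
    rw [extChartAt_cotangentBundle_apply ha, covectorCoord_self]
    rfl
  have hsource : cotangentLift I R ⟨a, 0⟩ ∈
      (extChartAt ((cotangentModel E I).prod (cotangentModel E I)) (a, a)).source := by
    rw [extChartAt_prod] at hRsource ⊢
    exact ⟨mem_extChartAt_cotangentBundle_source.2 hRsource.1,
      mem_extChartAt_cotangentBundle_source.2 hRsource.2⟩
  refine (extChartAt _ (a, a)).injOn hsource (mem_extChartAt_source _) ?_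
  refine (extChartAt_cotangentLift (w := 0) (hR.mdifferentiableAt (hR.zero_mem a.proj))
    hRsource).trans (((isLocalDiscretization_chartMap hR a.proj).localLift_zero a.snd).trans ?_)
  rw [extChartAt_prod]
  exact (Prod.ext hself hself).symm

theorem eventually_extChartAt_cotangentLift (hR : IsDiscretizationMap I U R)
    (a : CotangentBundle I M) : ∀ᶠ w : E × (E →L[ℝ] ℝ) in 𝓝 0,
      extChartAt ((cotangentModel E I).prod (cotangentModel E I)) (a, a)
          (cotangentLift I R ⟨a, w⟩) =
        localLift (chartMap I R a.proj) (extChartAt I a.proj a.proj) a.snd w := by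
  have hfiber : Continuous fun w : E × (E →L[ℝ] ℝ) => (⟨a.proj, w.1⟩ : TangentBundle I M) :=
    (contMDiff_fiber_inclusion a.proj (n := 0)).continuous.comp continuous_fst
  have hU : ∀ᶠ ξ in 𝓝 (⟨a.proj, 0⟩ : TangentBundle I M), ξ ∈ U :=
    hR.isOpen_domain.mem_nhds (hR.zero_mem a.proj)
  have hsource : ∀ᶠ ξ in 𝓝 (⟨a.proj, 0⟩ : TangentBundle I M),
      R ξ ∈ (extChartAt (I.prod I) (a.proj, a.proj)).source := by
    refine (hR.contMDiffAt (hR.zero_mem a.proj)).continuousAt ?_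
    rw [hR.map_zero]
    exact extChartAt_source_mem_nhds _
  exact (hfiber.tendsto' 0 _ rfl).eventually (hU.and hsource) |>.mono fun w hw =>
    extChartAt_cotangentLift (hR.mdifferentiableAt hw.1) hw.2

theorem fiberDeriv_cotangentLift_sub (hR : IsDiscretizationMap I U R) (a : CotangentBundle I M) :
    fiberDeriv (cotangentModel E I) (fun X => (cotangentLift I R X).2) a -
      fiberDeriv (cotangentModel E I) (fun X => (cotangentLift I R X).1) a =
      ContinuousLinearMap.id ℝ (E × (E →L[ℝ] ℝ)) := by
  have hlift : MDifferentiableAt (cotangentModel E I).tangent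
      ((cotangentModel E I).prod (cotangentModel E I)) (cotangentLift I R) ⟨a, 0⟩ :=
    ((contMDiffOn_cotangentLift hR.isOpen_domain hR.contMDiffOn).contMDiffAt
      ((isOpen_cotangentLiftDomain hR.isOpen_domain hR.contMDiffOn).mem_nhds
        (zero_mem_cotangentLiftDomain hR a))).mdifferentiableAt (by simp)
  have hfiber := hasFDerivAt_extChartAt_prod_fiber hlift (cotangentLift_zero hR a)
    (mem_extChartAt_source a)
  rw [tangentCoordChange_self_eq_id (mem_extChartAt_source a), ContinuousLinearMap.id_comp,
    ContinuousLinearMap.id_comp] at hfiber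
  have hlocal := (hfiber.congr_of_eventuallyEq
    ((eventually_extChartAt_cotangentLift hR a).mono fun _ hw => hw.symm)).fderiv
  refine ContinuousLinearMap.ext fun w => ?_
  have hsub := (isLocalDiscretization_chartMap hR a.proj).fderiv_localLift_sub a.snd w
  rw [hlocal] at hsub
  exact hsub

end Lift

end DiscretizationMap

end

theorem mainTheorem2_general {E : Type*} [NormedAddCommGroup E] [NormedSpace ℝ E] [CompleteSpace E]
    {H : Type*} [TopologicalSpace H] (I : ModelWithCorners ℝ E H) [I.Boundaryless]
    {Q : Type*} [TopologicalSpace Q] [ChartedSpace H Q] [IsManifold I ∞ Q]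
    (U : Set (TangentBundle I Q)) (R : TangentBundle I Q → Q × Q)
    (hR : DiscretizationMap.IsDiscretizationMap I U R) :
    DiscretizationMap.IsDiscretizationMap (DiscretizationMap.cotangentModel E I)
      (DiscretizationMap.cotangentLiftDomain I U R) (DiscretizationMap.cotangentLift I R) where
  isOpen_domain :=
    DiscretizationMap.isOpen_cotangentLiftDomain hR.isOpen_domain hR.contMDiffOn
  zero_mem := DiscretizationMap.zero_mem_cotangentLiftDomain hR
  contMDiffOn := DiscretizationMap.contMDiffOn_cotangentLift hR.isOpen_domain hR.contMDiffOn
  map_zero := DiscretizationMap.cotangentLift_zero hR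
  fiberDeriv_sub := DiscretizationMap.fiberDeriv_cotangentLift_sub hR

theorem mainTheorem2 {E : Type*} [NormedAddCommGroup E] [NormedSpace ℝ E] [FiniteDimensional ℝ E]
    {H : Type*} [TopologicalSpace H] (I : ModelWithCorners ℝ E H) [I.Boundaryless]
    {Q : Type*} [TopologicalSpace Q] [ChartedSpace H Q] [IsManifold I ∞ Q]
    (U : Set (TangentBundle I Q)) (R : TangentBundle I Q → Q × Q)
    (hR : DiscretizationMap.IsDiscretizationMap I U R) :
    DiscretizationMap.IsDiscretizationMap (DiscretizationMap.cotangentModel E I)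
      (DiscretizationMap.cotangentLiftDomain I U R) (DiscretizationMap.cotangentLift I R) := by
  have : CompleteSpace E := FiniteDimensional.complete ℝ E
  exact mainTheorem2_general I U R hR
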